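/- Let $\mathbb K$ be $\mathbb R$ or $\mathbb C$. An absolute-valued algebra over $\mathbb K$ is a (not necessarily associative or unital) $\mathbb K$-algebra $A$, i.e. a $\mathbb K$-vector space with a $\mathbb K$-bilinear product, endowed with a norm satisfying $\|xy\|=\|x\|\,\|y\|$ for all $x,y\in A$. For $e\in A$ let $L_e,R_e:A\to A$ be the linear maps $L_e(x)=ex$ and $R_e(x)=xe$; the element $e$ is called flexible if $(ex)e=e(xe)$ for all $x\in A$. Proposition 4.3. Let $A$ be an absolute-valued algebra over $\mathbb K$ of finite dimension $n\ge 2$, and let $e\in A$ be a nonzero flexible idempotent ($e\neq 0$ and $e^2=e$). Then there is a vector $u\in A$ with $\|u\|=1$ that is an eigenvector of both $L_e$ and $R_e$, such that the linear span of $\{e,u\}$ is a $2$-dimensional subalgebra of $A$ that is invariant under $L_e$ and $R_e$. -/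

import Mathlib

/-- The ring-theoretic and metric data of an absolute-valued algebra: a normed additive group with
a biadditive (not necessarily associative or unital) product such that `‖x * y‖ = ‖x‖ * ‖y‖`.
Together with `[NormedSpace 𝕜 A] [IsScalarTower 𝕜 A A] [SMulCommClass 𝕜 A A]`, which say that
the norm is a norm of `𝕜`-vector spaces and that the product is `𝕜`-bilinear, this is an
absolute-valued `𝕜`-algebra. -/
class AbsoluteValuedRing (A : Type*) extends NormedAddCommGroup A, NonUnitalNonAssocRing A where
  protected norm_mul' : ∀ x y : A, ‖x * y‖ = ‖x‖ * ‖y‖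

instance AbsoluteValuedRing.toNormMulClass (A : Type*) [AbsoluteValuedRing A] : NormMulClass A :=
  ⟨AbsoluteValuedRing.norm_mul'⟩

/-- An element `e` is flexible if `(e, x, e) = (e * x) * e - e * (x * e) = 0` for all `x`. -/
def IsFlexibleElem {A : Type*} [NonUnitalNonAssocRing A] (e : A) : Prop :=
  ∀ x : A, associator e x e = 0

/-! Right multiplications by unit vectors are isometries, so averaging the square of a nonzero
functional `φ (x * z)` over x in the unit ball gives a multiple of `‖z‖ ^ 2`: the norm is Euclidean.
If every endomorphism had an eigenvalue, the absence of zero divisors would force dimension at most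
one; hence the scalars are real and the dimension is even. Left and right multiplication by e are
then isometries that fix e and, by flexibility, commute. They preserve the odd-dimensional
orthogonal complement of e, so they share a unit eigenvector u there, with eigenvalues ±1. The
parallelogram law applied to the squares of e + u and e - u yields u * u = ±e, which closes the span
under products. -/

open Polynomial in
theorem Real.exists_isRoot_of_odd_natDegree (p : ℝ[X]) (hp : Odd p.natDegree) :
    ∃ x, p.IsRoot x := by
  induction h : p.natDegree using Nat.strong_induction_on generalizing p with
  | _ n ih =>
    have hp0 : p ≠ 0 := by rintro rfl; simp at hp
    have hu : ¬ IsUnit p := fun hu => by simp [natDegree_eq_zero_of_isUnit hu] at hp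
    obtain ⟨q, hq, r, rfl⟩ := WfDvdMonoid.exists_irreducible_factor hu hp0
    have hq0 : q ≠ 0 := hq.ne_zero
    have hr0 : r ≠ 0 := right_ne_zero_of_mul hp0
    rw [natDegree_mul hq0 hr0] at hp h
    have h2 := hq.natDegree_le_two
    have h0 := hq.natDegree_pos
    obtain h1 | h1 : q.natDegree = 1 ∨ q.natDegree = 2 := by omega
    · obtain ⟨x, hx⟩ := exists_root_of_degree_eq_one (degree_eq_iff_natDegree_eq hq0 |>.2 h1)
      exact ⟨x, by simp_all [IsRoot]⟩
    · rw [h1] at hp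
      obtain ⟨x, hx⟩ := ih r.natDegree (by omega) r (by grind) rfl
      exact ⟨x, by simp_all [IsRoot]⟩

open Polynomial in
theorem RingEquiv.exists_isRoot_of_map {K L : Type*} [Field K] [Field L] (φ : K ≃+* L) (p : K[X])
    (h : ∃ x, (p.map (φ : K →+* L)).IsRoot x) : ∃ x, p.IsRoot x := by
  obtain ⟨x, hx⟩ := h
  obtain ⟨y, rfl⟩ := φ.surjective x
  refine ⟨y, ?_⟩
  have hx' : (p.map (φ : K →+* L)).IsRoot ((φ : K →+* L) y) := hx
  exact hx'.of_map φ.injective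

-- In `RCLike`, `I = 0` is the real case and `im I = 1` the complex one.
open Polynomial in
theorem RCLike.exists_isRoot_of_odd_natDegree {𝕜 : Type*} [RCLike 𝕜] (h : (RCLike.I : 𝕜) = 0)
    (p : 𝕜[X]) (hp : Odd p.natDegree) : ∃ x, p.IsRoot x :=
  (RCLike.realRingEquiv h).exists_isRoot_of_map p
    (Real.exists_isRoot_of_odd_natDegree _ (by rwa [natDegree_map]))

theorem RCLike.isAlgClosed_of_im_I_eq_one {𝕜 : Type*} [RCLike 𝕜]
    (h : RCLike.im (RCLike.I : 𝕜) = 1) : IsAlgClosed 𝕜 :=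
  IsAlgClosed.of_exists_root 𝕜 fun p _ hp =>
    (RCLike.complexRingEquiv h).exists_isRoot_of_map p
      (IsAlgClosed.exists_root _ (by rw [Polynomial.degree_map]; exact hp.degree_pos.ne'))

/-! ### Common eigenvectors in odd dimension -/

section OddDimension

open Module Polynomial

variable {K V : Type*} [Field K] [AddCommGroup V] [Module K V] [FiniteDimensional K V]

theorem Module.End.exists_hasEigenvalue_of_odd_finrank
    (hK : ∀ p : K[X], Odd p.natDegree → ∃ x, p.IsRoot x) (hV : Odd (finrank K V)) (f : End K V) :
    ∃ c, f.HasEigenvalue c := by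
  obtain ⟨c, hc⟩ := hK f.charpoly (by rwa [LinearMap.charpoly_natDegree])
  exact ⟨c, (hasEigenvalue_iff_isRoot_charpoly f c).2 hc⟩

/-- Commuting endomorphisms of an odd-dimensional space have a common eigenvector, if odd-degree
polynomials have roots. -/
theorem Module.End.exists_common_hasEigenvector_of_odd_finrank
    (hK : ∀ p : K[X], Odd p.natDegree → ∃ x, p.IsRoot x) (hV : Odd (finrank K V))
    (f g : End K V) (hfg : Commute f g) :
    ∃ a b v, f.HasEigenvector a v ∧ g.HasEigenvector b v := by
  induction h : finrank K V using Nat.strong_induction_on generalizing V with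
  | _ n ih =>
    obtain ⟨c, hc⟩ := exists_hasEigenvalue_of_odd_finrank hK hV f
    set T : End K V := f - algebraMap K (End K V) c
    have hTf : Commute T f := (Commute.refl f).sub_left (Algebra.commutes c f)
    have hTg : Commute T g := hfg.sub_left (Algebra.commutes c g)
    have hsum := LinearMap.finrank_range_add_finrank_ker T
    have hker : f.eigenspace c = LinearMap.ker T := eigenspace_def
    -- The dimensions of kernel and range have odd sum, so exactly one is odd. Both spaces are
    -- stable under f and g, and the range is strictly smaller than V.
    by_cases hodd : Odd (finrank K (LinearMap.ker T))
    · have hinv : ∀ v ∈ LinearMap.ker T, g v ∈ LinearMap.ker T := fun v hv => by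
        have := LinearMap.congr_fun hTg.eq v
        simp only [Module.End.mul_apply, LinearMap.mem_ker] at this hv ⊢
        rw [this, hv, map_zero]
      obtain ⟨b, hb⟩ := exists_hasEigenvalue_of_odd_finrank hK hodd (g.restrict hinv)
      obtain ⟨v, hv⟩ := hb.exists_hasEigenvector
      have hv0 : (v : V) ≠ 0 := by simpa using hv.2
      refine ⟨c, b, v, ⟨hker.ge v.2, hv0⟩, mem_eigenspace_iff.2 ?_, hv0⟩
      simpa using congrArg Subtype.val hv.apply_eq_smul
    · have hpos : 0 < finrank K (LinearMap.ker T) := by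
        rw [← hker]
        have : Nontrivial (f.eigenspace c) := Submodule.nontrivial_iff_ne_bot.2 hc
        exact finrank_pos
      have hinv : ∀ k : End K V, Commute T k →
          ∀ v ∈ LinearMap.range T, k v ∈ LinearMap.range T := by
        rintro k hk _ ⟨w, rfl⟩
        exact ⟨k w, LinearMap.congr_fun hk.eq w⟩
      obtain ⟨a, b, v, hv, hv'⟩ := ih (finrank K (LinearMap.range T)) (by omega) (by grind)
        (f.restrict (hinv f hTf)) (g.restrict (hinv g hTg))
        (by ext v; exact LinearMap.congr_fun hfg.eq v) rfl
      have hv0 : (v : V) ≠ 0 := by simpa using hv.2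
      refine ⟨a, b, v, ⟨mem_eigenspace_iff.2 ?_, hv0⟩, mem_eigenspace_iff.2 ?_, hv0⟩
      · simpa using congrArg Subtype.val hv.apply_eq_smul
      · simpa using congrArg Subtype.val hv'.apply_eq_smul

end OddDimension

/-! ### Eigenvalues and zero divisors -/

theorem AbsoluteValuedRing.noZeroDivisors (A : Type*) [AbsoluteValuedRing A] :
    NoZeroDivisors A where
  eq_zero_or_eq_zero_of_mul_eq_zero {x y} h := by
    rw [← norm_eq_zero, norm_mul, mul_eq_zero] at h
    simpa using h

/-- A finite-dimensional algebra without zero divisors in which every endomorphism has an eigenvalue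
has dimension at most one. -/
theorem finrank_le_one_of_forall_exists_hasEigenvalue {K A : Type*} [Field K]
    [NonUnitalNonAssocRing A] [NoZeroDivisors A] [Module K A] [IsScalarTower K A A]
    [SMulCommClass K A A] [FiniteDimensional K A]
    (h : ∀ f : Module.End K A, ∃ c, f.HasEigenvalue c) : Module.finrank K A ≤ 1 := by
  rcases subsingleton_or_nontrivial A with hA | hA
  · simp [Module.finrank_zero_of_subsingleton]
  obtain ⟨a, ha⟩ := exists_ne (0 : A)
  have hinj : Function.Injective (LinearMap.mulLeft K a) := by
    rw [injective_iff_map_eq_zero]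
    intro x hx
    exact (mul_eq_zero.1 hx).resolve_left ha
  let E := LinearEquiv.ofInjectiveEndo (LinearMap.mulLeft K a) hinj
  refine finrank_le_one a fun b => ?_
  -- An eigenvector v of `L_a⁻¹ L_b` satisfies (c a - b) v = 0, so b = c a.
  obtain ⟨c, hc⟩ := h (E.symm.toLinearMap ∘ₗ LinearMap.mulLeft K b)
  obtain ⟨v, hv⟩ := hc.exists_hasEigenvector
  refine ⟨c, ?_⟩
  have h1 : E.symm (b * v) = c • v := hv.apply_eq_smul
  rw [LinearEquiv.symm_apply_eq, map_smul] at h1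
  have h2 : b * v = c • (a * v) := h1
  have h3 : (c • a - b) * v = 0 := by rw [sub_mul, smul_mul_assoc, h2, sub_self]
  exact sub_eq_zero.1 ((mul_eq_zero.1 h3).resolve_right hv.2)

/-! ### The norm is Euclidean -/

section Parallelogram

open MeasureTheory

/-- A linear automorphism scales Haar measure by a constant; an isometry maps the unit ball, of
finite positive measure, onto itself, so the constant is 1. -/
theorem LinearIsometryEquiv.measurePreserving_addHaar {E : Type*} [NormedAddCommGroup E]
    [NormedSpace ℝ E] [FiniteDimensional ℝ E] [MeasurableSpace E] [BorelSpace E]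
    (μ : Measure E) [μ.IsAddHaarMeasure] (f : E ≃ₗᵢ[ℝ] E) : MeasurePreserving f μ μ := by
  refine ⟨f.continuous.measurable, ?_⟩
  have hdet : LinearMap.det (f.toLinearEquiv : E →ₗ[ℝ] E) ≠ 0 :=
    (LinearEquiv.isUnit_det' f.toLinearEquiv).ne_zero
  have key := Measure.map_linearMap_addHaar_eq_smul_addHaar μ hdet
  have hcoe : (⇑(f.toLinearEquiv : E →ₗ[ℝ] E)) = f := rfl
  rw [hcoe] at key
  have hball := congrArg (fun ν => ν (Metric.ball 0 1)) key
  simp only [Measure.smul_apply, smul_eq_mul] at hball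
  rw [Measure.map_apply f.continuous.measurable measurableSet_ball, f.preimage_ball, map_zero]
    at hball
  have h1 : ENNReal.ofReal |(LinearMap.det (f.toLinearEquiv : E →ₗ[ℝ] E))⁻¹| = 1 :=
    ((ENNReal.mul_eq_right (Metric.measure_ball_pos μ _ one_pos).ne'
      measure_ball_lt_top.ne).1 hball.symm)
  rw [key, h1, one_smul]

/-- The norm of a finite-dimensional real absolute-valued algebra satisfies the parallelogram law:
it is proportional to the average of `x ↦ (φ (x * y)) ^ 2` over the unit ball. -/
theorem AbsoluteValuedRing.parallelogram {A : Type*} [AbsoluteValuedRing A]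
    [NormedSpace ℝ A] [IsScalarTower ℝ A A] [SMulCommClass ℝ A A] [FiniteDimensional ℝ A]
    (x y : A) : ‖x + y‖ * ‖x + y‖ + ‖x - y‖ * ‖x - y‖ = 2 * (‖x‖ * ‖x‖ + ‖y‖ * ‖y‖) := by
  rcases subsingleton_or_nontrivial A with hA | hA
  · simp [Subsingleton.elim _ (0 : A)]
  borelize A
  let μ : Measure A := Measure.addHaar
  obtain ⟨w, hw⟩ := exists_ne (0 : A)
  obtain ⟨φ, hφ⟩ := SeparatingDual.exists_ne_zero (R := ℝ) hw
  let B : Set A := Metric.ball 0 1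
  have hint : ∀ g : A → ℝ, Continuous g → IntegrableOn g B μ := fun g hg =>
    (hg.continuousOn.integrableOn_compact (isCompact_closedBall 0 1)).mono_set
      Metric.ball_subset_closedBall
  have hmul : ∀ z : A, Continuous fun x : A => x * z := fun z =>
    (LinearMap.mulRight ℝ z).continuous_of_finiteDimensional
  let c : ℝ := ∫ x in B, (φ x) ^ 2 ∂μ
  have hc : 0 < c := by
    refine (setIntegral_pos_iff_support_of_nonneg_ae (Filter.Eventually.of_forall fun x => sq_nonneg _)
      (hint _ (by fun_prop))).2 ?_
    refine IsOpen.measure_pos μ ?_ ?_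
    · exact ((by fun_prop : Continuous fun x => (φ x) ^ 2).isOpen_support).inter Metric.isOpen_ball
    · refine ⟨(2 * ‖w‖)⁻¹ • w, ?_, ?_⟩
      · have : ‖w‖ ≠ 0 := norm_ne_zero_iff.2 hw
        simp [hφ, this]
      · have : ‖w‖ ≠ 0 := norm_ne_zero_iff.2 hw
        simp [B, norm_smul]
        field_simp
        norm_num
  have hunit : ∀ z : A, ‖z‖ = 1 → ∫ x in B, (φ (x * z)) ^ 2 ∂μ = c := by
    intro z hz
    let R : A →ₗᵢ[ℝ] A := ⟨LinearMap.mulRight ℝ z, fun x => by simp [hz]⟩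
    let R' : A ≃ₗᵢ[ℝ] A := R.toLinearIsometryEquiv rfl
    have hR : ∀ x, R' x = x * z := fun x => rfl
    have hpre : R' ⁻¹' B = B := by simp [B, R'.preimage_ball]
    have := (R'.measurePreserving_addHaar μ).setIntegral_preimage_emb
      R'.toHomeomorph.measurableEmbedding (fun x => (φ x) ^ 2) B
    rw [hpre] at this
    simpa only [hR] using this
  have hQ : ∀ z : A, ∫ x in B, (φ (x * z)) ^ 2 ∂μ = c * (‖z‖ * ‖z‖) := by
    intro z
    rcases eq_or_ne z 0 with rfl | hz
    · simp
    have hz' : ‖z‖ ≠ 0 := norm_ne_zero_iff.2 hz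
    have h1 := hunit (‖z‖⁻¹ • z) (by simp [norm_smul, hz'])
    simp only [mul_smul_comm, map_smul, smul_eq_mul, mul_pow, integral_const_mul] at h1
    rw [← h1]
    field_simp
  have hI : ∀ z, IntegrableOn (fun x => (φ (x * z)) ^ 2) B μ := fun z =>
    hint _ ((φ.continuous.comp (hmul z)).pow 2)
  -- For each fixed a, the square of a linear form obeys the parallelogram law; integrate over a.
  have key : (∫ a in B, (φ (a * (x + y))) ^ 2 ∂μ) + ∫ a in B, (φ (a * (x - y))) ^ 2 ∂μ =
      2 * ((∫ a in B, (φ (a * x)) ^ 2 ∂μ) + ∫ a in B, (φ (a * y)) ^ 2 ∂μ) := by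
    rw [← integral_add (hI _) (hI _), ← integral_add (hI _) (hI _), ← integral_const_mul]
    congr 1
    ext a
    simp only [mul_add, mul_sub, map_add, map_sub]
    ring
  simp only [hQ] at key
  apply mul_left_cancel₀ hc.ne'
  linarith

end Parallelogram

/-- The norm of a finite-dimensional absolute-valued algebra comes from an inner product. -/
theorem AbsoluteValuedRing.innerProductSpaceable (𝕜 : Type*) [RCLike 𝕜] (A : Type*)
    [AbsoluteValuedRing A] [NormedSpace 𝕜 A] [IsScalarTower 𝕜 A A] [SMulCommClass 𝕜 A A]
    [FiniteDimensional 𝕜 A] : InnerProductSpaceable A := by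
  let _ : NormedSpace ℝ A := NormedSpace.restrictScalars ℝ 𝕜 A
  have : IsScalarTower ℝ 𝕜 A := ⟨fun r c x => by
    change (r • c) • x = (algebraMap ℝ 𝕜 r) • c • x
    rw [smul_smul, Algebra.smul_def]⟩
  have : FiniteDimensional ℝ A := FiniteDimensional.trans ℝ 𝕜 A
  have : IsScalarTower ℝ A A := ⟨fun r x y => by
    change ((algebraMap ℝ 𝕜 r) • x) * y = (algebraMap ℝ 𝕜 r) • (x * y)
    rw [smul_mul_assoc]⟩
  have : SMulCommClass ℝ A A := ⟨fun r x y => by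
    change (algebraMap ℝ 𝕜 r) • (x * y) = x * ((algebraMap ℝ 𝕜 r) • y)
    rw [mul_smul_comm]⟩
  exact ⟨AbsoluteValuedRing.parallelogram⟩

/-! ### Scalars, dimension and the vector u -/

/-- In a real or complex absolute-valued algebra of dimension at least two, the scalars are real and
the dimension is even. -/
theorem AbsoluteValuedRing.I_eq_zero_and_even_finrank {𝕜 : Type*} [RCLike 𝕜] {A : Type*}
    [AbsoluteValuedRing A] [NormedSpace 𝕜 A] [IsScalarTower 𝕜 A A] [SMulCommClass 𝕜 A A]
    [FiniteDimensional 𝕜 A] (hn : 2 ≤ Module.finrank 𝕜 A) :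
    (RCLike.I : 𝕜) = 0 ∧ Even (Module.finrank 𝕜 A) := by
  have hA : Nontrivial A := Module.nontrivial_of_finrank_pos (R := 𝕜) (by omega)
  have := AbsoluteValuedRing.noZeroDivisors A
  have hno : ¬ ∀ f : Module.End 𝕜 A, ∃ c, f.HasEigenvalue c := fun h => by
    have := finrank_le_one_of_forall_exists_hasEigenvalue h
    omega
  have hI : (RCLike.I : 𝕜) = 0 := by
    refine RCLike.I_eq_zero_or_im_I_eq_one.resolve_right fun h => ?_
    have := RCLike.isAlgClosed_of_im_I_eq_one h
    exact hno Module.End.exists_eigenvalue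
  refine ⟨hI, Nat.not_odd_iff_even.1 fun hodd => hno ?_⟩
  exact Module.End.exists_hasEigenvalue_of_odd_finrank
    (RCLike.exists_isRoot_of_odd_natDegree hI) hodd

/-- If `u` is a unit vector orthogonal to a unit idempotent `e`, with `e * u = ±u` and `u * e = ±u`,
then `u * u = ±e`. Orthogonality is expressed by the norms of `e + u` and `e - u`. -/
theorem AbsoluteValuedRing.mul_self_eq_or_eq_neg {A : Type*} [AbsoluteValuedRing A]
    [InnerProductSpaceable A] {e u : A} (he : e * e = e) (he1 : ‖e‖ = 1) (hu1 : ‖u‖ = 1)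
    (hadd : ‖e + u‖ * ‖e + u‖ = 2) (hsub : ‖e - u‖ * ‖e - u‖ = 2)
    (hl : e * u = u ∨ e * u = -u) (hr : u * e = u ∨ u * e = -u) :
    u * u = e ∨ u * u = -e := by
  have par := InnerProductSpaceable.parallelogram_identity (E := A)
  have huu : ‖u * u‖ = 1 := by simp [hu1]
  -- Since `(e ± u)²` has norm 2, `‖e + u²‖² + ‖eu + ue‖² = 4`. As eu + ue is ±2u or 0, either e +
  -- u² = 0, or `‖e + u²‖ = 2` and `h2` forces e - u² = 0.
  have h1 := par (e + u * u) (e * u + u * e)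
  have e1 : (e + u) * (e + u) = e + u * u + (e * u + u * e) := by
    rw [add_mul, mul_add, mul_add, he]; abel
  have e2 : (e - u) * (e - u) = e + u * u - (e * u + u * e) := by
    rw [sub_mul, mul_sub, mul_sub, he]; abel
  rw [← e1, ← e2, norm_mul, norm_mul, hadd, hsub] at h1
  have h2 := par e (u * u)
  rw [he1, huu] at h2
  have h3 := par u u
  rw [sub_self, norm_zero, hu1] at h3
  have hsame : ‖e * u + u * e‖ * ‖e * u + u * e‖ = 4 → u * u = -e := fun h => by
    have h0 : ‖e + u * u‖ * ‖e + u * u‖ = 0 := by linarith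
    rw [mul_self_eq_zero, norm_eq_zero] at h0
    exact (neg_eq_of_add_eq_zero_right h0).symm
  have hopp : e * u + u * e = 0 → u * u = e := fun h => by
    rw [h, norm_zero] at h1
    have h0 : ‖e - u * u‖ * ‖e - u * u‖ = 0 := by linarith
    rw [mul_self_eq_zero, norm_eq_zero] at h0
    exact (sub_eq_zero.1 h0).symm
  rcases hl with hl | hl <;> rcases hr with hr | hr
  · exact Or.inr (hsame (by rw [hl, hr]; linarith))
  · exact Or.inl (hopp (by rw [hl, hr, add_neg_cancel]))
  · exact Or.inl (hopp (by rw [hl, hr, neg_add_cancel]))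
  · exact Or.inr (hsame (by rw [hl, hr, ← neg_add, norm_neg]; linarith))

/-- Two commuting linear isometries of an even-dimensional inner product space over the reals with a
common fixed vector have a common unit eigenvector orthogonal to it. -/
theorem LinearIsometry.exists_common_hasEigenvector_orthogonal {𝕜 E : Type*} [RCLike 𝕜]
    [NormedAddCommGroup E] [InnerProductSpace 𝕜 E] [FiniteDimensional 𝕜 E]
    (hI : (RCLike.I : 𝕜) = 0) (hE : Even (Module.finrank 𝕜 E)) (f g : E →ₗᵢ[𝕜] E)
    (hfg : ∀ x, f (g x) = g (f x)) {e : E} (he : e ≠ 0) (hf : f e = e) (hg : g e = e) :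
    ∃ (a b : 𝕜) (u : E), ‖u‖ = 1 ∧ inner 𝕜 e u = 0 ∧ f u = a • u ∧ g u = b • u := by
  let W : Submodule 𝕜 E := (𝕜 ∙ e)ᗮ
  have hinv : ∀ k : E →ₗᵢ[𝕜] E, k e = e → ∀ v ∈ W, k.toLinearMap v ∈ W := fun k hk v hv => by
    rw [Submodule.mem_orthogonal_singleton_iff_inner_right] at hv ⊢
    have := k.inner_map_map e v
    rw [hk, hv] at this
    exact this
  have hdim : Odd (Module.finrank 𝕜 W) := by
    have h1 := Submodule.finrank_add_finrank_orthogonal (𝕜 ∙ e)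
    rw [finrank_span_singleton he] at h1
    change 1 + Module.finrank 𝕜 W = _ at h1
    grind
  obtain ⟨a, b, v, hv, hv'⟩ := Module.End.exists_common_hasEigenvector_of_odd_finrank
    (RCLike.exists_isRoot_of_odd_natDegree hI) hdim (f.toLinearMap.restrict (hinv f hf))
    (g.toLinearMap.restrict (hinv g hg)) (by ext v; exact hfg v)
  have hv0 : ‖(v : E)‖ ≠ 0 := by simpa using hv.2
  have hfv : f v = a • (v : E) := congrArg Subtype.val hv.apply_eq_smul
  have hgv : g v = b • (v : E) := congrArg Subtype.val hv'.apply_eq_smul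
  have hev : inner 𝕜 e (v : E) = 0 :=
    Submodule.mem_orthogonal_singleton_iff_inner_right.1 v.2
  refine ⟨a, b, ((‖(v : E)‖⁻¹ : ℝ) : 𝕜) • (v : E), ?_, ?_, ?_, ?_⟩
  · rw [norm_smul, RCLike.norm_ofReal, abs_of_nonneg (by positivity), inv_mul_cancel₀ hv0]
  · rw [inner_smul_right, hev, mul_zero]
  · rw [map_smul, hfv, smul_comm]
  · rw [map_smul, hgv, smul_comm]

theorem RCLike.eq_one_or_eq_neg_one_of_norm_eq_one {𝕜 : Type*} [RCLike 𝕜]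
    (hI : (RCLike.I : 𝕜) = 0) {a : 𝕜} (ha : ‖a‖ = 1) : a = 1 ∨ a = -1 := by
  have h : ((RCLike.re a : ℝ) : 𝕜) = a := (RCLike.realRingEquiv hI).left_inv a
  rw [← h, RCLike.norm_ofReal] at ha
  rcases (abs_eq zero_le_one).1 ha with h1 | h1
  · exact Or.inl (by rw [← h, h1, RCLike.ofReal_one])
  · exact Or.inr (by rw [← h, h1, RCLike.ofReal_neg, RCLike.ofReal_one])

/-- The span of a set that is closed under products up to linear combinations is a subalgebra. -/
def NonUnitalSubalgebra.ofSpan {R A : Type*} [CommSemiring R] [NonUnitalNonAssocSemiring A]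
    [Module R A] [IsScalarTower R A A] [SMulCommClass R A A] (s : Set A)
    (h : ∀ x ∈ s, ∀ y ∈ s, x * y ∈ Submodule.span R s) : NonUnitalSubalgebra R A :=
  { Submodule.span R s with
    mul_mem' := fun {a b} ha hb => by
      change a * b ∈ Submodule.span R s
      induction ha, hb using Submodule.span_induction₂ with
      | mem_mem x y hx hy => exact h x hx y hy
      | zero_left y hy => rw [zero_mul]; exact zero_mem _
      | zero_right x hx => rw [mul_zero]; exact zero_mem _
      | add_left x y z _ _ _ h1 h2 => rw [add_mul]; exact add_mem h1 h2
      | add_right x y z _ _ _ h1 h2 => rw [mul_add]; exact add_mem h1 h2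
      | smul_left r x y _ _ h1 => rw [smul_mul_assoc]; exact Submodule.smul_mem _ r h1
      | smul_right r x y _ _ h1 => rw [mul_smul_comm]; exact Submodule.smul_mem _ r h1 }

theorem proposition4p3 {𝕜 : Type*} [RCLike 𝕜] {A : Type*} [AbsoluteValuedRing A]
    [NormedSpace 𝕜 A] [IsScalarTower 𝕜 A A] [SMulCommClass 𝕜 A A] [FiniteDimensional 𝕜 A]
    (hn : 2 ≤ Module.finrank 𝕜 A)
    (e : A) (he0 : e ≠ 0) (he : IsIdempotentElem e) (hflex : IsFlexibleElem e) :
    ∃ (u : A) (B : NonUnitalSubalgebra 𝕜 A),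
      ‖u‖ = 1 ∧
      (∃ α : 𝕜, Module.End.HasEigenvector (LinearMap.mulLeft 𝕜 e) α u) ∧
      (∃ β : 𝕜, Module.End.HasEigenvector (LinearMap.mulRight 𝕜 e) β u) ∧
      B.toSubmodule = Submodule.span 𝕜 {e, u} ∧
      Module.finrank 𝕜 B = 2 ∧
      B.toSubmodule ∈ Module.End.invtSubmodule (LinearMap.mulLeft 𝕜 e) ∧
      B.toSubmodule ∈ Module.End.invtSubmodule (LinearMap.mulRight 𝕜 e) := by
  obtain ⟨hI, heven⟩ := AbsoluteValuedRing.I_eq_zero_and_even_finrank hn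
  have := AbsoluteValuedRing.innerProductSpaceable 𝕜 A
  -- Polarization keeps the given norm, so multiplications by e remain isometries.
  let _ : InnerProductSpace 𝕜 A :=
    InnerProductSpace.ofNorm 𝕜 InnerProductSpaceable.parallelogram_identity
  have hee : e * e = e := he
  have he1 : ‖e‖ = 1 := by
    have h := congrArg norm hee
    rw [norm_mul] at h
    exact mul_left_cancel₀ (norm_ne_zero_iff.2 he0) (h.trans (mul_one _).symm)
  let L : A →ₗᵢ[𝕜] A := ⟨LinearMap.mulLeft 𝕜 e, fun x => by simp [he1]⟩
  let R : A →ₗᵢ[𝕜] A := ⟨LinearMap.mulRight 𝕜 e, fun x => by simp [he1]⟩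
  obtain ⟨a, b, u, hu1, heu, hL, hR⟩ := L.exists_common_hasEigenvector_orthogonal hI heven R
    (fun x => (sub_eq_zero.1 (hflex x)).symm) he0 hee hee
  have hl : e * u = a • u := hL
  have hr : u * e = b • u := hR
  have hu0 : u ≠ 0 := norm_ne_zero_iff.1 (by rw [hu1]; exact one_ne_zero)
  have sign : ∀ (c : 𝕜) (x : A), x = c • u → ‖x‖ = 1 → x = u ∨ x = -u := by
    rintro c x rfl hx
    rw [norm_smul, hu1, mul_one] at hx
    rcases RCLike.eq_one_or_eq_neg_one_of_norm_eq_one hI hx with rfl | rfl <;> simp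
  have huu : u * u = e ∨ u * u = -e := by
    refine AbsoluteValuedRing.mul_self_eq_or_eq_neg hee he1 hu1 ?_ ?_
      (sign a _ hl (by rw [norm_mul, he1, hu1, mul_one]))
      (sign b _ hr (by rw [norm_mul, he1, hu1, mul_one]))
    · rw [norm_add_sq_eq_norm_sq_add_norm_sq_of_inner_eq_zero (𝕜 := 𝕜) e u heu, he1, hu1]; norm_num
    · rw [sub_eq_add_neg, norm_add_sq_eq_norm_sq_add_norm_sq_of_inner_eq_zero (𝕜 := 𝕜) e (-u)
        (by rw [inner_neg_right, heu, neg_zero]), norm_neg, he1, hu1]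
      norm_num
  have hmem_e : e ∈ Submodule.span 𝕜 {e, u} := Submodule.subset_span (by simp)
  have hmem_u : u ∈ Submodule.span 𝕜 {e, u} := Submodule.subset_span (by simp)
  let B : NonUnitalSubalgebra 𝕜 A := NonUnitalSubalgebra.ofSpan {e, u} (by
    rintro x (rfl | rfl) y (rfl | rfl)
    · rwa [hee]
    · rw [hl]; exact Submodule.smul_mem _ _ hmem_u
    · rw [hr]; exact Submodule.smul_mem _ _ hmem_u
    · rcases huu with h | h <;> rw [h]
      · exact hmem_e
      · exact neg_mem hmem_e)
  have heB : e ∈ B := hmem_e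
  refine ⟨u, B, hu1, ⟨a, Module.End.mem_eigenspace_iff.2 hl, hu0⟩,
    ⟨b, Module.End.mem_eigenspace_iff.2 hr, hu0⟩, rfl, ?_,
    fun x hx => B.mul_mem heB hx, fun x hx => B.mul_mem hx heB⟩
  have hind : LinearIndependent 𝕜 ![e, u] := by
    refine linearIndependent_of_ne_zero_of_inner_eq_zero ?_ ?_
    · intro i; fin_cases i <;> simpa
    · intro i j hij
      fin_cases i <;> fin_cases j <;> simp_all [inner_eq_zero_symm.1 heu]
  have hrank := finrank_span_eq_card hind
  rw [Matrix.range_cons_cons_empty, Fintype.card_fin] at hrank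
  exact hrank
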